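/- Let $L$ be a lattice with $\mathbb{Z}$-basis $e_1,\dots,e_n$ (that is, $L$ is a free abelian group of finite rank $n\ge 0$), and let $K$ be an arbitrary group acting on $L$ by group automorphisms. Write $(l)$, $l\in L$, for the $\mathbb{Z}$-basis elements of the group ring $\mathbb{Z}L$. The Koszul resolution $P_*$ of the trivial $\mathbb{Z}L$-module $\mathbb{Z}$ (with respect to the basis $e_1,\dots,e_n$) is the complex in which $P_i$ is the free $\mathbb{Z}L$-module on the generators $[s_1,\dots,s_i]$, $1\le s_1<\dots<s_i\le n$, with differential $$\partial[s_1,\dots,s_i]=\sum_{j=1}^{i}(-1)^{j-1}\bigl((0)-(e_{s_j})\bigr)\cdot[s_1,\dots,\widehat{s_j},\dots,s_i],$$ and with augmentation $P_0=\mathbb{Z}L\to\mathbb{Z}$, $(l)\mapsto 1$. A compatible $K$-action on $P_*$ is a family of augmentation-preserving chain maps of abelian groups $t_k\colon P_*\to P_*$, $k\in K$, such that $t_k\bigl((a)\cdot p\bigr)=(k\cdot a)\cdot t_k(p)$ for all $k\in K$, $a\in L$, $p\in P_*$, such that $t_kt_{k'}=t_{kk'}$ for all $k,k'\in K$, and such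 that $t_1=\mathrm{id}$. Let $F_n$ be the free group on $x_1,\dots,x_n$, let $\Gamma_2X=[X,X]$ denote the commutator subgroup of a group $X$, and let $\bar\pi\colon F_n/\Gamma_2\Gamma_2F_n\to L$ be the homomorphism induced by $x_i\mapsto e_i$. **Theorem.** There is a compatible $K$-action on the Koszul resolution $P_*$ if and only if the $K$-action on $L$ lifts to $F_n/\Gamma_2\Gamma_2F_n$, i.e. there is an action of $K$ on $F_n/\Gamma_2\Gamma_2F_n$ by group automorphisms such that $\bar\pi(k\cdot x)=k\cdot\bar\pi(x)$ for all $k\in K$ and $x\in F_n/\Gamma_2\Gamma_2F_n$. -/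

import Mathlib

open scoped AddMonoidAlgebra

noncomputable section

/-- The basis element `(l)` of the group ring `ℤL` of an additively written abelian group `L`. -/
def groupElt {L : Type*} [AddCommGroup L] (l : L) : ℤ[L] :=
  AddMonoidAlgebra.single l 1

/-- The augmentation `ℤL → ℤ`, the ring homomorphism with `(l) ↦ 1` for all `l`. A map that is
semilinear along it and takes values in `ℤ` is the same as a `ℤL`-linear map to the trivial
module `ℤ`. -/
def groupRingAugmentation (L : Type*) [AddCommGroup L] : ℤ[L] →+* ℤ :=
  (AddMonoidAlgebra.lift ℤ ℤ L (1 : Multiplicative L →* ℤ)).toRingHom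

theorem groupRingAugmentation_groupElt {L : Type*} [AddCommGroup L] (l : L) :
    groupRingAugmentation L (groupElt l) = 1 := by
  simp [groupRingAugmentation, groupElt]

/-- A compatible action of the group `K` on a complex `P` of `ℤA`-modules with augmentation
`ε : P₀ → ℤ`, where `K` acts `ℤ`-linearly on the abelian group `A`: augmentation-preserving chain
maps `t k : P → P` that are semilinear over the action of `k` on `A` and satisfy
`t (k * k') = t k ∘ t k'` and `t 1 = id`. -/
structure CompatibleAction (K : Type*) [Group K] {A : Type*} [AddCommGroup A]
    [DistribMulAction K A] (P : ChainComplex (ModuleCat ℤ[A]) ℕ)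
    (ε : P.X 0 →ₛₗ[groupRingAugmentation A] ℤ) where
  /-- The action of an element of `K` in each degree. -/
  t : K → ∀ i : ℕ, P.X i →+ P.X i
  comm_d : ∀ (k : K) (i j : ℕ) (p : P.X i), t k j (P.d i j p) = P.d i j (t k i p)
  augmentation : ∀ (k : K) (p : P.X 0), ε (t k 0 p) = ε p
  map_groupElt_smul : ∀ (k : K) (i : ℕ) (a : A) (p : P.X i),
    t k i (groupElt a • p) = groupElt (k • a) • t k i p
  map_mul : ∀ (k k' : K) (i : ℕ) (p : P.X i), t (k * k') i p = t k i (t k' i p)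
  map_one : ∀ (i : ℕ) (p : P.X i), t 1 i p = p

section Koszul

variable {L : Type*} [AddCommGroup L] {n : ℕ}

/-- The degree `i` part of the Koszul complex: the free `ℤL`-module on the generators
`[σ 0, …, σ (i - 1)]`, one for each strictly increasing sequence `σ` of `i` elements of the index
set `{0, …, n - 1}` of the basis of `L`. -/
abbrev KoszulModule (L : Type*) [AddCommGroup L] (n i : ℕ) : Type _ :=
  (Fin i ↪o Fin n) →₀ ℤ[L]

/-- The sequence `σ` with its entry at position `j` left out. -/
def omitIndex {i : ℕ} (σ : Fin (i + 1) ↪o Fin n) (j : Fin (i + 1)) : Fin i ↪o Fin n :=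
  (Fin.succAboveOrderEmb j).trans σ

/-- The Koszul differential, `[σ] ↦ ∑ j, (-1) ^ j ((0) - (e (σ j))) [σ with σ j left out]`, with
positions `j` counted from `0`. -/
def koszulDifferential (e : Module.Basis (Fin n) ℤ L) (i : ℕ) :
    KoszulModule L n (i + 1) →ₗ[ℤ[L]] KoszulModule L n i :=
  Finsupp.linearCombination ℤ[L] fun σ =>
    ∑ j : Fin (i + 1), ((-1) ^ (j : ℕ) * (groupElt 0 - groupElt (e (σ j)))) •
      Finsupp.single (omitIndex σ j) 1

theorem koszulDifferential_single (e : Module.Basis (Fin n) ℤ L) (i : ℕ)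
    (σ : Fin (i + 1) ↪o Fin n) :
    koszulDifferential e i (Finsupp.single σ 1) =
      ∑ j : Fin (i + 1), ((-1) ^ (j : ℕ) * (groupElt 0 - groupElt (e (σ j)))) •
        Finsupp.single (omitIndex σ j) 1 := by
  simp [koszulDifferential]

theorem koszulDifferential_comp (e : Module.Basis (Fin n) ℤ L) (i : ℕ) :
    koszulDifferential e i ∘ₗ koszulDifferential e (i + 1) = 0 := by
  refine Finsupp.lhom_ext' fun σ => LinearMap.ext_ring ?_
  simp only [LinearMap.comp_apply, Finsupp.lsingle_apply, LinearMap.zero_apply,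
    koszulDifferential_single, map_sum, map_smul, Finset.smul_sum, smul_smul]
  rw [Finset.sum_sigma']
  refine Finset.sum_involution (fun x _ => ⟨x.1.succAbove x.2, x.2.predAbove x.1⟩) ?_ ?_ ?_ ?_
  · rintro ⟨a, b⟩ -
    have h1 : omitIndex (omitIndex σ (a.succAbove b)) (b.predAbove a) =
        omitIndex (omitIndex σ a) b := by
      ext c
      simp [omitIndex, Fin.succAbove_succAbove_succAbove_predAbove]
    have h2 : omitIndex σ (a.succAbove b) (b.predAbove a) = σ a := by
      simp [omitIndex, Fin.succAbove_succAbove_predAbove]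
    have h3 : omitIndex σ a b = σ (a.succAbove b) := rfl
    have h4 := Fin.neg_one_pow_succAbove_add_predAbove (R := ℤ[L]) a b
    rw [pow_add, pow_add] at h4
    dsimp only
    rw [h1, h2, h3, ← add_smul]
    have h5 : ((-1) ^ (a : ℕ) * (groupElt 0 - groupElt (e (σ a))) *
          ((-1) ^ (b : ℕ) * (groupElt 0 - groupElt (e (σ (a.succAbove b))))) +
        (-1) ^ (a.succAbove b : ℕ) * (groupElt 0 - groupElt (e (σ (a.succAbove b)))) *
          ((-1) ^ (b.predAbove a : ℕ) * (groupElt 0 - groupElt (e (σ a)))) : ℤ[L]) = 0 := by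
      linear_combination ((groupElt 0 - groupElt (e (σ a)) : ℤ[L]) *
        (groupElt 0 - groupElt (e (σ (a.succAbove b))))) * h4
    rw [h5, zero_smul]
  · rintro ⟨a, b⟩ - - h
    exact Fin.succAbove_ne a b (congrArg Sigma.fst h)
  · intro x _
    exact Finset.mem_univ _
  · rintro ⟨a, b⟩ -
    simp [Fin.succAbove_succAbove_predAbove, Fin.predAbove_predAbove_succAbove]

/-- The Koszul complex over `ℤL` of the lattice `L` with basis `e`. -/
def koszulComplex (e : Module.Basis (Fin n) ℤ L) : ChainComplex (ModuleCat ℤ[L]) ℕ :=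
  ChainComplex.of (fun i => ModuleCat.of ℤ[L] (KoszulModule L n i))
    (fun i => ModuleCat.ofHom (koszulDifferential e i))
    (fun i => by
      rw [← ModuleCat.ofHom_comp, koszulDifferential_comp]
      rfl)

theorem koszulComplex_d (e : Module.Basis (Fin n) ℤ L) (i : ℕ) :
    (koszulComplex e).d (i + 1) i = ModuleCat.ofHom (koszulDifferential e i) :=
  ChainComplex.of_d (fun i => ModuleCat.of ℤ[L] (KoszulModule L n i))
    (fun i => ModuleCat.ofHom (koszulDifferential e i)) i

/-- The augmentation `P₀ → ℤ` of the Koszul complex: `P₀` is free of rank one on the generator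
`[]` of the empty sequence, and `x • [] ↦ x ↦` its image under `ℤL → ℤ`. -/
def koszulAugmentation (e : Module.Basis (Fin n) ℤ L) :
    (koszulComplex e).X 0 →ₛₗ[groupRingAugmentation L] ℤ where
  toFun p := groupRingAugmentation L
    ((show KoszulModule L n 0 from p) (OrderEmbedding.ofIsEmpty : Fin 0 ↪o Fin n))
  map_add' _ _ := _root_.map_add (groupRingAugmentation L) _ _
  map_smul' _ _ := _root_.map_mul (groupRingAugmentation L) _ _

/-- The augmentation vanishes on boundaries, so it really augments the Koszul complex. -/
theorem koszulAugmentation_d (e : Module.Basis (Fin n) ℤ L) (p : (koszulComplex e).X 1) :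
    koszulAugmentation e ((koszulComplex e).d 1 0 p) = 0 := by
  rw [koszulComplex_d]
  change KoszulModule L n 1 at p
  change groupRingAugmentation L (koszulDifferential e 0 p _) = 0
  induction p using Finsupp.induction_linear with
  | zero => simp
  | add p q hp hq => rw [_root_.map_add, Finsupp.add_apply, _root_.map_add, hp, hq, add_zero]
  | single σ a =>
    rw [← mul_one a, ← smul_eq_mul, ← Finsupp.smul_single, map_smul, koszulDifferential_single]
    have h : (OrderEmbedding.ofIsEmpty : Fin 0 ↪o Fin n) = omitIndex σ 0 := by
      ext c
      exact c.elim0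
    simp [h, groupRingAugmentation_groupElt]

end Koszul

/-- `F_n / Γ₂Γ₂F_n`, the free metabelian group of rank `n`, where `Γ₂` is the commutator
subgroup. -/
abbrev FreeMetabelianGroup (n : ℕ) : Type :=
  FreeGroup (Fin n) ⧸ ⁅commutator (FreeGroup (Fin n)), commutator (FreeGroup (Fin n))⁆

/-- The homomorphism `F_n / Γ₂Γ₂F_n → L` with `x_i ↦ e_i`. -/
def freeMetabelianProj {L : Type*} [AddCommGroup L] {n : ℕ} (e : Module.Basis (Fin n) ℤ L) :
    FreeMetabelianGroup n →* Multiplicative L :=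
  QuotientGroup.lift _ (FreeGroup.lift fun i => Multiplicative.ofAdd (e i)) <| by
    refine (Subgroup.commutator_le_left _ _).trans ?_
    exact Abelianization.commutator_subset_ker _

/-- The action of `K` on `L` lifts to an action of `K` by group automorphisms on
`F_n / Γ₂Γ₂F_n`, along the projection `x_i ↦ e_i`. -/
def ActionLiftsToFreeMetabelianGroup (K : Type*) [Group K] {L : Type*} [AddCommGroup L]
    [DistribMulAction K L] {n : ℕ} (e : Module.Basis (Fin n) ℤ L) : Prop :=
  ∃ φ : K →* MulAut (FreeMetabelianGroup n), ∀ (k : K) (x : FreeMetabelianGroup n),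
    (freeMetabelianProj e (φ k x)).toAdd = k • (freeMetabelianProj e x).toAdd

end

/-! Both conditions are equivalent to a third one, `DegreeOneAction`: a semilinear `K`-action on `P₁
= (ℤL)ⁿ` for which `∂ : P₁ → ℤL` is equivariant, where `K` acts on `ℤL` in the standard way.

Koszul side. The Koszul complex is the exterior algebra of `P₁` with contraction by `∂` as
differential, so the exterior powers of such an action form chain maps
(`koszulDifferential_wedgeMap`). Conversely, a compatible action sends the generator of `P₀` to `u_k
• []`. The `u_k` satisfy a cocycle rule and hence are units, and dividing the degree one part by
`u_k` makes `∂` equivariant (`CompatibleAction.toDegreeOneAction`).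

Group side. The Magnus homomorphism sends `x` to the pair `(Dx, l)` in `(ℤL)ⁿ ⋊ L`, where `Dx` is
the vector of Fox derivatives and `l` the image of `x` in `L`. It is injective
(`foxDeriv_injective`), and its image consists of the pairs `(v, l)` with `∂v = (0) - (l)`
(`koszulBoundary_foxDeriv`, `exists_foxDeriv_eq`). An action in degree one preserves this condition
and so acts on the group. Conversely, a lift to the group gives the semilinear maps `[i] ↦ D(k ·
x_i)`. -/

noncomputable section

/-! ### Exterior powers of semilinear maps, in coordinates -/

section Wedge

variable {R S U : Type*} [CommRing R] [CommRing S] [CommRing U] {n : ℕ}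

/-- The `i`-fold wedge product on `Rⁿ`, with values in the free module on the increasing
sequences of `i` indices; its coordinates are the `i × i` minors. -/
def wedge (R : Type*) [CommRing R] (n i : ℕ) :
    (Fin n → R) [⋀^Fin i]→ₗ[R] ((Fin i ↪o Fin n) →₀ R) :=
  (Finsupp.linearEquivFunOnFinite R R (Fin i ↪o Fin n)).symm.toLinearMap.compAlternatingMap
    (AlternatingMap.pi fun τ =>
      Matrix.detRowAlternating.compLinearMap (LinearMap.funLeft R R (τ : Fin i → Fin n)))

theorem wedge_apply {i : ℕ} (v : Fin i → Fin n → R) (τ : Fin i ↪o Fin n) :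
    wedge R n i v τ = (Matrix.of fun a b => v a (τ b)).det :=
  rfl

theorem wedge_basis {i : ℕ} (σ : Fin i ↪o Fin n) :
    wedge R n i (fun a => Pi.single (σ a) 1) = Finsupp.single σ 1 := by
  ext τ
  rw [wedge_apply]
  by_cases h : σ = τ
  · subst h
    rw [Finsupp.single_eq_same, ← Matrix.det_one (n := Fin i)]
    congr 1
    ext a b
    simp [Matrix.one_apply, Pi.single_apply, eq_comm]
  · rw [Finsupp.single_eq_of_ne' h]
    -- Distinct increasing sequences of equal length have different ranges, so the minor has a zero
    -- row.
    have : ∃ a, σ a ∉ Set.range τ := by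
      by_contra! hc
      refine h (OrderEmbedding.range_inj.1 ?_)
      refine Set.eq_of_subset_of_ncard_le (by rintro _ ⟨a, rfl⟩; exact hc a) ?_ (Set.toFinite _)
      rw [← Set.image_univ, ← Set.image_univ, Set.ncard_image_of_injective _ σ.injective,
        Set.ncard_image_of_injective _ τ.injective]
    obtain ⟨a, ha⟩ := this
    refine Matrix.det_eq_zero_of_row_eq_zero a fun b => ?_
    rw [Matrix.of_apply, Pi.single_eq_of_ne]
    exact fun hb => ha ⟨b, hb⟩

/-- Alternating maps on `Rⁿ` that agree on increasing sequences of basis vectors are equal. -/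
theorem AlternatingMap.ext_orderEmbedding {N : Type*} [AddCommGroup N] [Module R N] {i : ℕ}
    {f g : (Fin n → R) [⋀^Fin i]→ₗ[R] N}
    (h : ∀ σ : Fin i ↪o Fin n,
      f (fun a => Pi.single (σ a) 1) = g (fun a => Pi.single (σ a) 1)) : f = g := by
  refine Module.Basis.ext_alternating (Pi.basisFun R (Fin n)) fun v hv => ?_
  -- Sorting makes an injective index sequence increasing and changes both values by the same sign.
  have hs : StrictMono (v ∘ Tuple.sort v) :=
    (Tuple.monotone_sort v).strictMono_of_injective (hv.comp (Equiv.injective _))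
  have h1 := h (OrderEmbedding.ofStrictMono _ hs)
  have h2 : (fun a => Pi.single ((OrderEmbedding.ofStrictMono _ hs) a) 1 : Fin i → Fin n → R) =
      (fun a => Pi.basisFun R (Fin n) (v a)) ∘ Tuple.sort v := by
    funext a
    simp
  rw [h2, AlternatingMap.map_perm, AlternatingMap.map_perm] at h1
  exact MulAction.injective _ h1

theorem Finsupp.semilinearMap_ext {ι N : Type*} [AddCommGroup N] [Module S N] {φ : R →+* S}
    {f g : (ι →₀ R) →ₛₗ[φ] N} (h : ∀ a, f (Finsupp.single a 1) = g (Finsupp.single a 1)) :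
    f = g := by
  ext a
  simpa using h a

/-- The map induced on the free module on increasing sequences, seen as the `i`-th exterior power
of `Rⁿ`, by a semilinear map. -/
def wedgeMap {φ : R →+* S} (T : (Fin n → R) →ₛₗ[φ] (Fin n → S)) (i : ℕ) :
    ((Fin i ↪o Fin n) →₀ R) →ₛₗ[φ] ((Fin i ↪o Fin n) →₀ S) where
  toFun p := p.sum fun σ a => φ a • wedge S n i fun b => T (Pi.single (σ b) 1)
  map_add' p q := by
    refine Finsupp.sum_add_index' (fun σ => ?_) fun σ a b => ?_
    · rw [map_zero, zero_smul]
    · rw [map_add, add_smul]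
  map_smul' c p := by
    have h0 (σ : Fin i ↪o Fin n) : φ 0 • (wedge S n i fun b => T (Pi.single (σ b) 1)) = 0 := by
      rw [map_zero, zero_smul]
    rw [Finsupp.sum_smul_index h0, Finsupp.smul_sum]
    simp only [map_mul, mul_smul]

theorem wedgeMap_apply {φ : R →+* S} (T : (Fin n → R) →ₛₗ[φ] (Fin n → S)) (i : ℕ)
    (p : (Fin i ↪o Fin n) →₀ R) : wedgeMap T i p =
      p.sum fun σ a => φ a • wedge S n i fun b => T (Pi.single (σ b) 1) :=
  rfl

theorem wedgeMap_single {φ : R →+* S} (T : (Fin n → R) →ₛₗ[φ] (Fin n → S)) {i : ℕ}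
    (σ : Fin i ↪o Fin n) :
    wedgeMap T i (Finsupp.single σ 1) = wedge S n i fun b => T (Pi.single (σ b) 1) := by
  rw [wedgeMap_apply, Finsupp.sum_single_index, map_one, one_smul]
  rw [map_zero, zero_smul]

/-- `wedgeMap` is prescribed on basis vectors only; functoriality needs the formula for arbitrary
vectors. -/
theorem wedgeMap_wedge {φ : R →+* S} (T : (Fin n → R) →ₛₗ[φ] (Fin n → S)) {i : ℕ}
    (v : Fin i → Fin n → R) :
    wedgeMap T i (wedge R n i v) = wedge S n i fun a => T (v a) := by
  -- Restriction of scalars along `φ` makes both sides `R`-alternating in `v`, so increasing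
  -- sequences of basis vectors suffice.
  let _ : Module R S := Module.compHom S φ
  let T' : (Fin n → R) →ₗ[R] (Fin n → S) :=
    { toFun := T
      map_add' := map_add T
      map_smul' := fun c v => by rw [map_smulₛₗ]; rfl }
  let W : ((Fin i ↪o Fin n) →₀ R) →ₗ[R] ((Fin i ↪o Fin n) →₀ S) :=
    { toFun := wedgeMap T i
      map_add' := map_add _
      map_smul' := fun c v => by rw [map_smulₛₗ]; ext; rfl }
  let f : (Fin n → R) [⋀^Fin i]→ₗ[R] ((Fin i ↪o Fin n) →₀ S) := W.compAlternatingMap (wedge R n i)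
  let w : (Fin n → S) [⋀^Fin i]→ₗ[R] ((Fin i ↪o Fin n) →₀ S) :=
    { toFun := wedge S n i
      map_update_add' := fun v a x y => (wedge S n i).map_update_add v a x y
      map_update_smul' := fun v a c x => by
        have := (wedge S n i).map_update_smul v a (φ c) x
        refine Eq.trans this ?_
        ext; rfl
      map_eq_zero_of_eq' := (wedge S n i).map_eq_zero_of_eq' }
  let g := w.compLinearMap T'
  have : f = g := AlternatingMap.ext_orderEmbedding fun σ => by
    change wedgeMap T i (wedge R n i _) = wedge S n i _
    rw [wedge_basis, wedgeMap_single]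
    rfl
  exact DFunLike.congr_fun this v

theorem wedgeMap_comp {φ : R →+* S} {ψ : S →+* U} {χ : R →+* U} [RingHomCompTriple φ ψ χ]
    (T : (Fin n → R) →ₛₗ[φ] (Fin n → S)) (T' : (Fin n → S) →ₛₗ[ψ] (Fin n → U)) (i : ℕ) :
    wedgeMap (T'.comp T) i = (wedgeMap T' i).comp (wedgeMap T i) := by
  refine Finsupp.semilinearMap_ext fun σ => ?_
  rw [LinearMap.comp_apply, wedgeMap_single, wedgeMap_single, wedgeMap_wedge]
  rfl

theorem wedgeMap_id (i : ℕ) :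
    wedgeMap (LinearMap.id : (Fin n → R) →ₗ[R] (Fin n → R)) i = LinearMap.id := by
  refine Finsupp.semilinearMap_ext fun σ => ?_
  rw [wedgeMap_single, LinearMap.id_apply, ← wedge_basis]
  rfl

theorem wedgeMap_zero {φ : R →+* S} (T : (Fin n → R) →ₛₗ[φ] (Fin n → S))
    (p : (Fin 0 ↪o Fin n) →₀ R) (σ : Fin 0 ↪o Fin n) : wedgeMap T 0 p σ = φ (p σ) := by
  have hp : p = p σ • Finsupp.single σ 1 := by
    ext τ
    rw [show τ = σ from DFunLike.ext _ _ fun a => a.elim0]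
    simp
  rw [hp, map_smulₛₗ, wedgeMap_single]
  simp [wedge_apply]

end Wedge

/-! ### The Koszul differential as a contraction -/

section Koszul

variable {L : Type*} [AddCommGroup L] {n : ℕ}

/-- The degree one Koszul differential in coordinates. -/
def koszulBoundary (e : Module.Basis (Fin n) ℤ L) : (Fin n → ℤ[L]) →ₗ[ℤ[L]] ℤ[L] :=
  Fintype.linearCombination ℤ[L] fun i => groupElt 0 - groupElt (e i)

theorem koszulBoundary_single (e : Module.Basis (Fin n) ℤ L) (i : Fin n) (a : ℤ[L]) :
    koszulBoundary e (Pi.single i a) = a * (groupElt 0 - groupElt (e i)) := by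
  simp [koszulBoundary]

/-- The right side is the alternatization of `v ↦ ∂v₀ • (v₁ ∧ ⋯ ∧ vᵢ)`, so both sides are
alternating and can be compared on basis vectors. In this form the differential depends on `∂`
alone. -/
theorem koszulDifferential_wedge (e : Module.Basis (Fin n) ℤ L) (i : ℕ)
    (v : Fin (i + 1) → Fin n → ℤ[L]) :
    koszulDifferential e i (wedge ℤ[L] n (i + 1) v) =
      ∑ j : Fin (i + 1), ((-1) ^ (j : ℕ) * koszulBoundary e (v j)) •
        wedge ℤ[L] n i (j.removeNth v) := by
  have : (koszulDifferential e i).compAlternatingMap (wedge ℤ[L] n (i + 1)) =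
      AlternatingMap.alternatizeUncurryFin ((koszulBoundary e).smulRight (wedge ℤ[L] n i)) := by
    refine AlternatingMap.ext_orderEmbedding fun σ => ?_
    rw [AlternatingMap.alternatizeUncurryFin_apply, LinearMap.compAlternatingMap_apply,
      wedge_basis, koszulDifferential_single]
    refine Finset.sum_congr rfl fun j _ => ?_
    rw [LinearMap.smulRight_apply, AlternatingMap.smul_apply, koszulBoundary_single, one_mul,
      ← wedge_basis, mul_smul]
    rw [← Int.cast_smul_eq_zsmul ℤ[L]]
    push_cast
    rfl
  have := DFunLike.congr_fun this v
  rw [LinearMap.compAlternatingMap_apply, AlternatingMap.alternatizeUncurryFin_apply] at this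
  rw [this]
  refine Finset.sum_congr rfl fun j _ => ?_
  rw [LinearMap.smulRight_apply, AlternatingMap.smul_apply, mul_smul,
    ← Int.cast_smul_eq_zsmul ℤ[L]]
  push_cast
  rfl

theorem koszulDifferential_wedgeMap (e : Module.Basis (Fin n) ℤ L) {φ : ℤ[L] →+* ℤ[L]}
    (T : (Fin n → ℤ[L]) →ₛₗ[φ] (Fin n → ℤ[L]))
    (hT : ∀ v, koszulBoundary e (T v) = φ (koszulBoundary e v)) (i : ℕ)
    (p : KoszulModule L n (i + 1)) :
    koszulDifferential e i (wedgeMap T (i + 1) p) = wedgeMap T i (koszulDifferential e i p) := by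
  have : (koszulDifferential e i).comp (wedgeMap T (i + 1)) =
      (wedgeMap T i).comp (koszulDifferential e i) := by
    refine Finsupp.semilinearMap_ext fun σ => ?_
    rw [LinearMap.comp_apply, LinearMap.comp_apply, wedgeMap_single, koszulDifferential_wedge,
      koszulDifferential_single, map_sum]
    refine Finset.sum_congr rfl fun j _ => ?_
    rw [map_smulₛₗ, wedgeMap_single, hT, koszulBoundary_single, one_mul, map_mul, map_pow,
      map_neg, map_one]
    rfl
  exact DFunLike.congr_fun this p

end Koszul

/-! ### Fox calculus and the image of the Magnus embedding -/

section Fox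

open scoped commutatorElement

variable {L : Type*} [AddCommGroup L] {n : ℕ}

theorem groupElt_zero : (groupElt 0 : ℤ[L]) = 1 :=
  rfl

theorem groupElt_add (a b : L) : (groupElt (a + b) : ℤ[L]) = groupElt a * groupElt b := by
  simp [groupElt, AddMonoidAlgebra.single_mul_single]

theorem groupRing_addHom_ext {N : Type*} [AddCommGroup N] {f g : ℤ[L] →+ N}
    (h : ∀ l, f (groupElt l) = g (groupElt l)) : f = g := by
  refine AddMonoidAlgebra.addMonoidHom_ext fun l => ?_
  exact DFunLike.congr_fun (f := f.comp (AddMonoidAlgebra.singleAddHom l))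
    (g := g.comp (AddMonoidAlgebra.singleAddHom l)) (AddMonoidHom.ext_int (h l))

theorem groupRing_pi_addHom_ext {N : Type*} [AddCommGroup N] {f g : (Fin n → ℤ[L]) →+ N}
    (h : ∀ l i, f ((groupElt l : ℤ[L]) • Pi.single i 1) = g ((groupElt l : ℤ[L]) • Pi.single i 1)) :
    f = g := by
  refine AddMonoidHom.functions_ext _ _ _ fun i a => ?_
  refine DFunLike.congr_fun (f := f.comp (AddMonoidHom.single (fun _ => ℤ[L]) i))
    (g := g.comp (AddMonoidHom.single (fun _ => ℤ[L]) i)) (groupRing_addHom_ext fun l => ?_) a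
  have := h l i
  rw [← Pi.single_smul, smul_eq_mul, mul_one] at this
  exact this

/-- The `i`-th generator of the free metabelian group. -/
def FreeMetabelianGroup.of (i : Fin n) : FreeMetabelianGroup n :=
  QuotientGroup.mk (FreeGroup.of i)

theorem FreeMetabelianGroup.induction {C : FreeMetabelianGroup n → Prop}
    (one : C 1) (of : ∀ i, C (.of i)) (inv : ∀ x, C x → C x⁻¹)
    (mul : ∀ x y, C x → C y → C (x * y)) (x : FreeMetabelianGroup n) : C x := by
  induction x using QuotientGroup.induction_on with
  | H a =>
    induction a using FreeGroup.induction_on with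
    | C1 => exact one
    | of i => exact of i
    | inv_of i h => exact inv _ h
    | mul a b ha hb => exact mul _ _ ha hb

/-- The image in `L` of an element of the free metabelian group. -/
def toLattice (e : Module.Basis (Fin n) ℤ L) (x : FreeMetabelianGroup n) : L :=
  (freeMetabelianProj e x).toAdd

variable (e : Module.Basis (Fin n) ℤ L)

@[simp]
theorem toLattice_one : toLattice e 1 = 0 := by
  simp [toLattice]

@[simp]
theorem toLattice_mul (x y : FreeMetabelianGroup n) :
    toLattice e (x * y) = toLattice e x + toLattice e y := by
  simp [toLattice]

@[simp]
theorem toLattice_inv (x : FreeMetabelianGroup n) : toLattice e x⁻¹ = -toLattice e x := by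
  simp [toLattice]

@[simp]
theorem toLattice_of (i : Fin n) : toLattice e (.of i) = e i := by
  simp [toLattice, freeMetabelianProj, FreeMetabelianGroup.of]

theorem toLattice_surjective : Function.Surjective (toLattice e) := by
  intro l
  have hl : l ∈ Submodule.span ℤ (Set.range e) := by rw [e.span_eq]; trivial
  induction hl using Submodule.span_induction with
  | mem l h =>
    obtain ⟨i, rfl⟩ := h
    exact ⟨.of i, toLattice_of e i⟩
  | zero => exact ⟨1, toLattice_one e⟩
  | add a b _ _ ha hb =>
    obtain ⟨x, rfl⟩ := ha
    obtain ⟨y, rfl⟩ := hb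
    exact ⟨x * y, toLattice_mul e x y⟩
  | smul c a _ ha =>
    obtain ⟨x, rfl⟩ := ha
    exact ⟨x ^ c, by simp [toLattice]⟩

/-- The kernel of the homomorphism from the free group to a free abelian group that takes free
generators to a basis is the commutator subgroup. -/
theorem mem_commutator_of_lift_eq_one {a : FreeGroup (Fin n)}
    (ha : FreeGroup.lift (fun i => Multiplicative.ofAdd (e i)) a = 1) :
    a ∈ commutator (FreeGroup (Fin n)) := by
  -- Sending `e_i` to the class of `x_i` factors the abelianization map through the lift.
  let q : L →ₗ[ℤ] Additive (Abelianization (FreeGroup (Fin n))) :=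
    e.constr ℤ fun i => Additive.ofMul (Abelianization.of (FreeGroup.of i))
  have hq (i : Fin n) : q (e i) = Additive.ofMul (Abelianization.of (FreeGroup.of i)) :=
    e.constr_basis ℤ _ i
  clear_value q
  have h : (AddMonoidHom.toMultiplicativeLeft q.toAddMonoidHom).comp
      (FreeGroup.lift fun i => Multiplicative.ofAdd (e i)) = Abelianization.of := by
    ext i
    simp [AddMonoidHom.toMultiplicativeLeft, hq]
  have h1 := DFunLike.congr_fun h a
  rw [MonoidHom.comp_apply, ha, map_one] at h1
  rw [← Abelianization.ker_of, MonoidHom.mem_ker, ← h1]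

theorem commute_of_toLattice_eq_zero {x y : FreeMetabelianGroup n} (hx : toLattice e x = 0)
    (hy : toLattice e y = 0) : x * y = y * x := by
  induction x using QuotientGroup.induction_on with
  | H a =>
    induction y using QuotientGroup.induction_on with
    | H b =>
      have ha := mem_commutator_of_lift_eq_one e (a := a) hx
      have hb := mem_commutator_of_lift_eq_one e (a := b) hy
      rw [← commutatorElement_eq_one_iff_mul_comm]
      exact (QuotientGroup.eq_one_iff ⁅a, b⁆).2 (Subgroup.commutator_mem_commutator ha hb)

/-- The action of `L` on `(ℤL)ⁿ` by multiplication. -/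
def latticeMulAut (L : Type*) [AddCommGroup L] (n : ℕ) :
    Multiplicative L →* MulAut (Multiplicative (Fin n → ℤ[L])) :=
  (MulAutMultiplicative (Fin n → ℤ[L])).symm.toMonoidHom.comp
    ((DistribMulAction.toAddAut ℤ[L]ˣ (Fin n → ℤ[L])).comp
      (AddMonoidAlgebra.of ℤ L).toHomUnits)

theorem latticeMulAut_apply (l : Multiplicative L) (v : Multiplicative (Fin n → ℤ[L])) :
    latticeMulAut L n l v = Multiplicative.ofAdd (groupElt l.toAdd • v.toAdd) :=
  rfl

/-- The Magnus homomorphism on the free group. -/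
def magnusFree : FreeGroup (Fin n) →*
    Multiplicative (Fin n → ℤ[L]) ⋊[latticeMulAut L n] Multiplicative L :=
  FreeGroup.lift fun i => ⟨Multiplicative.ofAdd (Pi.single i 1), Multiplicative.ofAdd (e i)⟩

/-- The Magnus homomorphism on the free metabelian group. -/
def magnus : FreeMetabelianGroup n →*
    Multiplicative (Fin n → ℤ[L]) ⋊[latticeMulAut L n] Multiplicative L :=
  QuotientGroup.lift _ (magnusFree e) <| by
    -- The commutator subgroup maps into the abelian normal factor `(ℤL)ⁿ`, so its images commute.
    have h (a : FreeGroup (Fin n)) (ha : a ∈ commutator (FreeGroup (Fin n))) :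
        (magnusFree e a).right = 1 :=
      Abelianization.commutator_subset_ker (SemidirectProduct.rightHom.comp (magnusFree e)) ha
    refine Subgroup.commutator_le.2 fun a ha b hb => ?_
    rw [MonoidHom.mem_ker, map_commutatorElement, commutatorElement_eq_one_iff_mul_comm]
    ext1
    · rw [SemidirectProduct.mul_left, SemidirectProduct.mul_left, h a ha, h b hb, map_one]
      exact mul_comm (magnusFree e a).left (magnusFree e b).left
    · rw [SemidirectProduct.mul_right, SemidirectProduct.mul_right, mul_comm]

theorem magnus_of (i : Fin n) : magnus e (.of i) =
    ⟨Multiplicative.ofAdd (Pi.single i 1), Multiplicative.ofAdd (e i)⟩ :=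
  FreeGroup.lift_apply_of

theorem magnus_right (x : FreeMetabelianGroup n) :
    (magnus e x).right.toAdd = toLattice e x := by
  induction x using FreeMetabelianGroup.induction with
  | one => simp
  | of i => simp [magnus_of]
  | inv x h => simp [h]
  | mul x y hx hy => simp [hx, hy]

/-- The vector of Fox derivatives of an element of the free metabelian group. -/
def foxDeriv (x : FreeMetabelianGroup n) : Fin n → ℤ[L] :=
  (magnus e x).left.toAdd

theorem foxDeriv_mul (x y : FreeMetabelianGroup n) :
    foxDeriv e (x * y) = foxDeriv e x + groupElt (toLattice e x) • foxDeriv e y := by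
  rw [foxDeriv, map_mul, SemidirectProduct.mul_left, latticeMulAut_apply, magnus_right]
  rfl

theorem foxDeriv_of (i : Fin n) : foxDeriv e (.of i) = Pi.single i 1 := by
  rw [foxDeriv, magnus_of]
  rfl

theorem foxDeriv_one : foxDeriv e 1 = 0 := by
  rw [foxDeriv, map_one]
  rfl

/-- A criterion for two derivations along a homomorphism to `L` to be equal. -/
theorem derivation_ext {f : FreeMetabelianGroup n → L} (hf : ∀ x y, f (x * y) = f x + f y)
    {N : Type*} [AddCommGroup N] [Module ℤ[L] N] {D D' : FreeMetabelianGroup n → N}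
    (hD : ∀ x y, D (x * y) = D x + (groupElt (f x) : ℤ[L]) • D y)
    (hD' : ∀ x y, D' (x * y) = D' x + (groupElt (f x) : ℤ[L]) • D' y)
    (h : ∀ i, D (.of i) = D' (.of i)) (x : FreeMetabelianGroup n) : D x = D' x := by
  have hf1 : f 1 = 0 := by simpa using hf 1 1
  have hone {E : FreeMetabelianGroup n → N}
      (hE : ∀ x y, E (x * y) = E x + (groupElt (f x) : ℤ[L]) • E y) : E 1 = 0 := by
    have := hE 1 1
    rwa [hf1, groupElt_zero, one_smul, mul_one, left_eq_add] at this
  have hinv {E : FreeMetabelianGroup n → N}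
      (hE : ∀ x y, E (x * y) = E x + (groupElt (f x) : ℤ[L]) • E y) (x : FreeMetabelianGroup n) :
      E x⁻¹ = -(groupElt (f x⁻¹) : ℤ[L]) • E x := by
    have := hE x⁻¹ x
    rw [inv_mul_cancel, hone hE] at this
    rw [neg_smul, eq_neg_iff_add_eq_zero, ← this]
  induction x using FreeMetabelianGroup.induction with
  | one => rw [hone hD, hone hD']
  | of i => exact h i
  | inv x hx => rw [hinv hD, hinv hD', hx]
  | mul x y hx hy => rw [hD, hD', hx, hy]

/-- The fundamental formula of Fox calculus: both sides are derivations that agree on generators. -/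
theorem koszulBoundary_foxDeriv (x : FreeMetabelianGroup n) :
    koszulBoundary e (foxDeriv e x) = groupElt 0 - groupElt (toLattice e x) := by
  refine derivation_ext (f := toLattice e) (toLattice_mul e)
    (D := fun x => koszulBoundary e (foxDeriv e x))
    (D' := fun x => groupElt 0 - groupElt (toLattice e x)) (fun x y => ?_) (fun x y => ?_)
    (fun i => ?_) x
  · rw [foxDeriv_mul, map_add, map_smul]
  · rw [toLattice_mul, groupElt_add, groupElt_zero, smul_eq_mul]
    ring
  · rw [foxDeriv_of, koszulBoundary_single, one_mul, toLattice_of]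

/-- The kernel of the projection of the free metabelian group to `L`. -/
abbrev ProjKer : Subgroup (FreeMetabelianGroup n) :=
  (freeMetabelianProj e).ker

theorem mem_projKer {x : FreeMetabelianGroup n} : x ∈ ProjKer e ↔ toLattice e x = 0 :=
  Iff.rfl

instance : CommGroup (ProjKer e) where
  mul_comm x y := Subtype.ext (commute_of_toLattice_eq_zero e x.2 y.2)

/-- A set-theoretic section of the projection to `L`. -/
def latticeSection (l : L) : FreeMetabelianGroup n :=
  Function.surjInv (toLattice_surjective e) l

@[simp]
theorem toLattice_latticeSection (l : L) : toLattice e (latticeSection e l) = l :=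
  Function.surjInv_eq _ l

/-- The loop that follows `x` from `l` to `l + x`, closed up with the chosen section. -/
def schreier (l : L) (x : FreeMetabelianGroup n) : ProjKer e :=
  ⟨latticeSection e l * x * (latticeSection e (l + toLattice e x))⁻¹, by
    rw [mem_projKer]
    simp⟩

theorem schreier_mul (l : L) (x y : FreeMetabelianGroup n) :
    schreier e l (x * y) = schreier e l x * schreier e (l + toLattice e x) y := by
  ext
  simp [schreier, mul_assoc, add_assoc]

/-- The additive map with `(l) [i] ↦ schreier l x_i`. -/
def schreierHom : (Fin n → ℤ[L]) →+ Additive (ProjKer e) :=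
  ∑ i : Fin n, ((Finsupp.liftAddHom fun l =>
      zmultiplesHom (Additive (ProjKer e)) (Additive.ofMul (schreier e l (.of i)))).comp
    (AddMonoidAlgebra.coeffAddEquiv (R := ℤ) (M := L)).toAddMonoidHom).comp
      (Pi.evalAddMonoidHom (fun _ => ℤ[L]) i)

theorem schreierHom_smul_single (l : L) (i : Fin n) :
    schreierHom e (groupElt l • Pi.single i 1) = Additive.ofMul (schreier e l (.of i)) := by
  rw [schreierHom, AddMonoidHom.finsetSum_apply, Finset.sum_eq_single i]
  · simp [groupElt]
  · intro j _ hj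
    simp [hj]
  · simp

/-- If `(l)[i]` is read as the edge from `l` to `l + e_i` in the Cayley graph of `L`, then `(l) •
Dx` is the chain of the path spelled by `x` from `l`. Both sides obey the same rule for concatenated
paths. -/
theorem schreierHom_smul_foxDeriv (l : L) (x : FreeMetabelianGroup n) :
    schreierHom e (groupElt l • foxDeriv e x) = Additive.ofMul (schreier e l x) := by
  induction x using FreeMetabelianGroup.induction generalizing l with
  | one =>
    rw [foxDeriv_one, smul_zero, map_zero, eq_comm, ofMul_eq_zero]
    ext
    simp [schreier]
  | of i => rw [foxDeriv_of, schreierHom_smul_single]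
  | inv x h =>
    have h1 := foxDeriv_mul e x⁻¹ x
    have h2 := schreier_mul e l x⁻¹ x
    have h3 : schreier e l 1 = 1 := by
      ext
      simp [schreier]
    rw [inv_mul_cancel, foxDeriv_one, eq_comm, ← eq_neg_iff_add_eq_zero] at h1
    rw [inv_mul_cancel, h3, eq_comm, ← eq_inv_iff_mul_eq_one] at h2
    rw [h1, smul_neg, map_neg, smul_smul, ← groupElt_add, h, h2, ofMul_inv]
  | mul x y hx hy =>
    rw [foxDeriv_mul, smul_add, map_add, hx, smul_smul, ← groupElt_add, hy, schreier_mul,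
      ofMul_mul]

/-- The loop of `x` at `0` is determined by `Dx`, and cancelling the section elements recovers `x`.
-/
theorem foxDeriv_injective {x y : FreeMetabelianGroup n} (hD : foxDeriv e x = foxDeriv e y)
    (hL : toLattice e x = toLattice e y) : x = y := by
  have h : schreier e 0 x = schreier e 0 y := by
    apply Additive.ofMul.injective
    rw [← schreierHom_smul_foxDeriv, ← schreierHom_smul_foxDeriv, hD]
  have h1 := congrArg Subtype.val h
  simpa [schreier, hL] using h1

/-- The restriction of the Fox derivative to the kernel of the projection to `L`, where it is
additive. -/
def foxDerivKer : Additive (ProjKer e) →+ (Fin n → ℤ[L]) where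
  toFun x := foxDeriv e x.toMul
  map_zero' := foxDeriv_one e
  map_add' x y := by
    have hx : toLattice e x.toMul = 0 := x.toMul.2
    rw [toMul_add, Subgroup.coe_mul, foxDeriv_mul, hx, groupElt_zero, one_smul]

/-- The additive map with `(l) ↦ foxDeriv (latticeSection l)`. -/
def sectionDeriv : ℤ[L] →+ (Fin n → ℤ[L]) :=
  (Finsupp.liftAddHom fun l => zmultiplesHom _ (foxDeriv e (latticeSection e l))).comp
    (AddMonoidAlgebra.coeffAddEquiv (R := ℤ) (M := L)).toAddMonoidHom

theorem sectionDeriv_groupElt (l : L) :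
    sectionDeriv e (groupElt l) = foxDeriv e (latticeSection e l) := by
  simp [sectionDeriv, groupElt]

/-- `schreierHom` inverts `D` up to a term that depends only on `∂v`; this yields preimages of
vectors with prescribed boundary. -/
theorem foxDerivKer_schreierHom (v : Fin n → ℤ[L]) :
    foxDerivKer e (schreierHom e v) = v + sectionDeriv e (koszulBoundary e v) := by
  have : (foxDerivKer e).comp (schreierHom e) =
      AddMonoidHom.id _ + (sectionDeriv e).comp (koszulBoundary e).toAddMonoidHom := by
    refine groupRing_pi_addHom_ext fun l i => ?_
    have h1 := foxDeriv_mul e (schreier e l (.of i)) (latticeSection e (l + e i))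
    -- Expanding `D` of this element in both ways gives the identity on `(l)[i]`.
    have h2 : (schreier e l (.of i) : FreeMetabelianGroup n) * latticeSection e (l + e i) =
      latticeSection e l * .of i := by simp [schreier]
    have h3 : toLattice e (schreier e l (.of i)) = 0 := (schreier e l (.of i)).2
    rw [h2, foxDeriv_mul, h3, groupElt_zero, one_smul, toLattice_latticeSection, foxDeriv_of] at h1
    change foxDeriv e (schreierHom e (groupElt l • Pi.single i 1)).toMul =
      groupElt l • Pi.single i 1 + sectionDeriv e (koszulBoundary e (groupElt l • Pi.single i 1))
    rw [schreierHom_smul_single, map_smul, koszulBoundary_single, one_mul, smul_eq_mul, mul_sub,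
      ← groupElt_add, ← groupElt_add, add_zero, map_sub, sectionDeriv_groupElt,
      sectionDeriv_groupElt, toMul_ofMul, eq_comm, add_sub, sub_eq_iff_eq_add, ← h1, add_comm]
  exact DFunLike.congr_fun this v

theorem exists_foxDeriv_eq {v : Fin n → ℤ[L]} {l : L}
    (h : koszulBoundary e v = groupElt 0 - groupElt l) :
    ∃ x, foxDeriv e x = v ∧ toLattice e x = l := by
  have h1 := foxDerivKer_schreierHom e v
  set m := schreierHom e v
  -- `latticeSection e 0` lies in the kernel but need not be `1`; `z` cancels its contribution to
  -- `sectionDeriv e (∂v)`.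
  let z : Additive (ProjKer e) := Additive.ofMul
    ⟨latticeSection e 0, (mem_projKer e).2 (toLattice_latticeSection e 0)⟩
  have hz : foxDerivKer e z = sectionDeriv e (groupElt 0) := (sectionDeriv_groupElt e 0).symm
  have hmz : toLattice e (m - z).toMul = 0 := (m - z).toMul.2
  refine ⟨(m - z).toMul * latticeSection e l, ?_, ?_⟩
  · rw [foxDeriv_mul, hmz, groupElt_zero, one_smul, ← sectionDeriv_groupElt]
    change foxDerivKer e (m - z) + _ = v
    rw [map_sub, h1, h, hz, map_sub]
    abel
  · rw [toLattice_mul, hmz, toLattice_latticeSection, zero_add]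

end Fox

/-! ### Passing between the actions on the complex, in degree one and on the group -/

section Actions

variable {K : Type*} [Group K] {L : Type*} [AddCommGroup L] [DistribMulAction K L] {n : ℕ}

/-- The ring endomorphism of `ℤL` induced by the action of `k` on `L`. -/
def groupRingMap (L : Type*) [AddCommGroup L] [DistribMulAction K L] (k : K) : ℤ[L] →+* ℤ[L] :=
  AddMonoidAlgebra.mapDomainRingHom ℤ (DistribSMul.toAddMonoidHom L k)

theorem groupRingMap_groupElt (k : K) (l : L) :
    groupRingMap L k (groupElt l) = groupElt (k • l) := by
  simp [groupRingMap, groupElt]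

theorem groupRingMap_mul (k k' : K) (a : ℤ[L]) :
    groupRingMap L (k * k') a = groupRingMap L k (groupRingMap L k' a) :=
  DFunLike.congr_fun (f := (groupRingMap L (k * k')).toAddMonoidHom)
    (g := (groupRingMap L k).toAddMonoidHom.comp (groupRingMap L k').toAddMonoidHom)
    (groupRing_addHom_ext fun l => by simp [groupRingMap_groupElt, mul_smul]) a

theorem groupRingMap_compTriple (k k' : K) :
    RingHomCompTriple (groupRingMap L k') (groupRingMap L k) (groupRingMap L (k * k')) :=
  ⟨RingHom.ext fun a => (groupRingMap_mul k k' a).symm⟩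

theorem groupRingMap_one (a : ℤ[L]) : groupRingMap L (1 : K) a = a :=
  DFunLike.congr_fun (f := (groupRingMap L (1 : K)).toAddMonoidHom) (g := AddMonoidHom.id _)
    (groupRing_addHom_ext fun l => by simp [groupRingMap_groupElt]) a

theorem groupRingAugmentation_groupRingMap (k : K) (a : ℤ[L]) :
    groupRingAugmentation L (groupRingMap L k a) = groupRingAugmentation L a :=
  DFunLike.congr_fun
    (f := (groupRingAugmentation L).toAddMonoidHom.comp (groupRingMap L k).toAddMonoidHom)
    (g := (groupRingAugmentation L).toAddMonoidHom)
    (groupRing_addHom_ext fun l => by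
      simp [groupRingMap_groupElt, groupRingAugmentation_groupElt]) a

/-- The elements `(l)` generate `ℤL` additively. -/
theorem map_smul_of_map_groupElt_smul {M N : Type*} [AddCommGroup M] [Module ℤ[L] M]
    [AddCommGroup N] [Module ℤ[L] N] (k : K) (f : M →+ N)
    (hf : ∀ (l : L) (p : M),
      f ((groupElt l : ℤ[L]) • p) = (groupElt (k • l) : ℤ[L]) • f p) (a : ℤ[L]) (p : M) :
    f (a • p) = groupRingMap L k a • f p :=
  DFunLike.congr_fun (f := f.comp ((AddMonoidHom.flip (smulAddHom ℤ[L] M)) p))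
    (g := ((AddMonoidHom.flip (smulAddHom ℤ[L] N)) (f p)).comp (groupRingMap L k).toAddMonoidHom)
    (groupRing_addHom_ext fun l => by simp [groupRingMap_groupElt, hf]) a

/-- A semilinear action of `K` on the degree one part of the Koszul complex for which the
differential to `ℤL` is equivariant. -/
structure DegreeOneAction (K : Type*) [Group K] {L : Type*} [AddCommGroup L]
    [DistribMulAction K L] {n : ℕ} (e : Module.Basis (Fin n) ℤ L) where
  /-- The action of an element of `K`. -/
  T : ∀ k : K, (Fin n → ℤ[L]) →ₛₗ[groupRingMap L k] (Fin n → ℤ[L])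
  boundary : ∀ (k : K) (v : Fin n → ℤ[L]),
    koszulBoundary e (T k v) = groupRingMap L k (koszulBoundary e v)
  map_mul : ∀ (k k' : K) (v : Fin n → ℤ[L]), T (k * k') v = T k (T k' v)
  map_one : ∀ v : Fin n → ℤ[L], T 1 v = v

variable (e : Module.Basis (Fin n) ℤ L)

/-- An equivariant action in degree one extends to a compatible action on the Koszul complex by
exterior powers. -/
def DegreeOneAction.toCompatibleAction {e : Module.Basis (Fin n) ℤ L} (A : DegreeOneAction K e) :
    CompatibleAction K (koszulComplex e) (koszulAugmentation e) where
  t k i := (wedgeMap (A.T k) i).toAddMonoidHom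
  comm_d k i j p := by
    by_cases h : j + 1 = i
    · subst h
      rw [koszulComplex_d]
      exact (koszulDifferential_wedgeMap e (A.T k) (A.boundary k) j p).symm
    · rw [(koszulComplex e).shape i j h]
      exact map_zero (wedgeMap (A.T k) j)
  augmentation k p := by
    exact (congrArg (groupRingAugmentation L) (wedgeMap_zero (A.T k) p _)).trans
      (groupRingAugmentation_groupRingMap k _)
  map_groupElt_smul k i a p := by
    refine (map_smulₛₗ (wedgeMap (A.T k) i) (groupElt a) p).trans ?_
    rw [groupRingMap_groupElt]
    rfl
  map_mul k k' i p := by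
    have := groupRingMap_compTriple (L := L) k k'
    have h : A.T (k * k') = (A.T k).comp (A.T k') := LinearMap.ext (A.map_mul k k')
    change wedgeMap (A.T (k * k')) i p = _
    rw [h, wedgeMap_comp]
    rfl
  map_one i p := by
    have h : groupRingMap L (1 : K) = RingHom.id _ := RingHom.ext groupRingMap_one
    -- The ring map of `1` is only propositionally the identity, so it is generalized before
    -- substitution.
    have h1 (φ : ℤ[L] →+* ℤ[L]) (hφ : φ = RingHom.id _)
        (T : (Fin n → ℤ[L]) →ₛₗ[φ] (Fin n → ℤ[L]))
        (hT : ∀ v, T v = v) (q : KoszulModule L n i) : wedgeMap T i q = q := by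
      subst hφ
      have : T = LinearMap.id := LinearMap.ext hT
      rw [this, wedgeMap_id, LinearMap.id_apply]
    exact h1 _ h (A.T 1) A.map_one p

/-- Increasing sequences of length one are indices. -/
def singletonSequenceEquiv (n : ℕ) : (Fin 1 ↪o Fin n) ≃ Fin n where
  toFun σ := σ 0
  invFun i := OrderEmbedding.ofStrictMono (fun _ => i) (Subsingleton.strictMono _)
  left_inv σ := by
    ext a
    rw [Subsingleton.elim a 0]
    rfl
  right_inv _ := rfl

/-- Coordinates on the degree one part of the Koszul complex. -/
def degreeOneEquiv (L : Type*) [AddCommGroup L] (n : ℕ) :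
    KoszulModule L n 1 ≃ₗ[ℤ[L]] (Fin n → ℤ[L]) :=
  (Finsupp.domLCongr (singletonSequenceEquiv n)).trans
    (Finsupp.linearEquivFunOnFinite ℤ[L] ℤ[L] (Fin n))

theorem koszulBoundary_degreeOneEquiv (p : KoszulModule L n 1) (σ : Fin 0 ↪o Fin n) :
    koszulBoundary e (degreeOneEquiv L n p) = koszulDifferential e 0 p σ := by
  have : (koszulBoundary e).comp (degreeOneEquiv L n).toLinearMap =
      (Finsupp.lapply σ).comp (koszulDifferential e 0) := by
    refine Finsupp.semilinearMap_ext fun τ => ?_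
    have h : omitIndex τ 0 = σ := DFunLike.ext _ _ fun a => a.elim0
    rw [LinearMap.comp_apply, LinearMap.comp_apply, koszulDifferential_single]
    simp [degreeOneEquiv, koszulBoundary_single, h]
    rfl
  exact DFunLike.congr_fun this p

/-! ### Normalizing a compatible action by its degree zero cocycle -/

section OfCompatible

variable {e} (C : CompatibleAction K (koszulComplex e) (koszulAugmentation e))

/-- A compatible action in degree `i`, on the explicit free module. -/
def CompatibleAction.koszulMap (k : K) (i : ℕ) :
    KoszulModule L n i →ₛₗ[groupRingMap L k] KoszulModule L n i where
  toFun := C.t k i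
  map_add' p q := map_add (C.t k i) p q
  map_smul' a p := map_smul_of_map_groupElt_smul (M := KoszulModule L n i)
    (N := KoszulModule L n i) k (C.t k i) (C.map_groupElt_smul k i) a p

/-- The image under `k` of the generator in degree zero. -/
def CompatibleAction.degreeZeroUnit (k : K) : ℤ[L] :=
  C.koszulMap k 0 (Finsupp.single OrderEmbedding.ofIsEmpty 1) OrderEmbedding.ofIsEmpty

theorem CompatibleAction.koszulMap_zero (k : K) (p : KoszulModule L n 0) :
    C.koszulMap k 0 p OrderEmbedding.ofIsEmpty =
      groupRingMap L k (p OrderEmbedding.ofIsEmpty) * C.degreeZeroUnit k := by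
  have hp : p = p OrderEmbedding.ofIsEmpty • Finsupp.single OrderEmbedding.ofIsEmpty 1 := by
    ext τ
    rw [show τ = OrderEmbedding.ofIsEmpty from DFunLike.ext _ _ fun a => a.elim0]
    simp
  conv_lhs => rw [hp, map_smulₛₗ]
  rfl

/-- For `k' = k⁻¹` this cocycle rule exhibits an inverse of `degreeZeroUnit k`. -/
theorem CompatibleAction.degreeZeroUnit_mul (k k' : K) : C.degreeZeroUnit (k * k') =
    groupRingMap L k (C.degreeZeroUnit k') * C.degreeZeroUnit k := by
  rw [CompatibleAction.degreeZeroUnit,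
    show C.koszulMap (k * k') 0 (Finsupp.single OrderEmbedding.ofIsEmpty 1) =
      C.koszulMap k 0 (C.koszulMap k' 0 (Finsupp.single OrderEmbedding.ofIsEmpty 1)) from
      C.map_mul k k' 0 _, C.koszulMap_zero]
  rfl

theorem CompatibleAction.degreeZeroUnit_one : C.degreeZeroUnit 1 = 1 := by
  rw [CompatibleAction.degreeZeroUnit,
    show C.koszulMap 1 0 (Finsupp.single OrderEmbedding.ofIsEmpty 1) =
      Finsupp.single OrderEmbedding.ofIsEmpty 1 from C.map_one 0 _, Finsupp.single_eq_same]

/-- The inverse of `degreeZeroUnit`. -/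
def CompatibleAction.degreeZeroInv (k : K) : ℤ[L] :=
  groupRingMap L k (C.degreeZeroUnit k⁻¹)

theorem CompatibleAction.degreeZeroInv_mul_unit (k : K) :
    C.degreeZeroInv k * C.degreeZeroUnit k = 1 := by
  rw [CompatibleAction.degreeZeroInv, ← C.degreeZeroUnit_mul, mul_inv_cancel,
    C.degreeZeroUnit_one]

/-- This twisted rule keeps the rescaled degree one maps multiplicative in `k`. -/
theorem CompatibleAction.degreeZeroInv_mul (k k' : K) : C.degreeZeroInv (k * k') =
    C.degreeZeroInv k * groupRingMap L k (C.degreeZeroInv k') := by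
  rw [CompatibleAction.degreeZeroInv, mul_inv_rev, C.degreeZeroUnit_mul, groupRingMap_mul,
    _root_.map_mul, ← groupRingMap_mul k' k'⁻¹, mul_inv_cancel, groupRingMap_one,
    _root_.map_mul]
  rfl

theorem CompatibleAction.degreeZeroInv_one : C.degreeZeroInv 1 = 1 := by
  rw [CompatibleAction.degreeZeroInv, inv_one, C.degreeZeroUnit_one, _root_.map_one]

/-- The degree one part of a compatible action, normalized to be equivariant for the standard
action on `ℤL`. -/
def CompatibleAction.toDegreeOneAction : DegreeOneAction K e where
  T k :=
    { toFun := fun v => C.degreeZeroInv k •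
        degreeOneEquiv L n (C.koszulMap k 1 ((degreeOneEquiv L n).symm v))
      map_add' := fun v w => by simp only [map_add, smul_add]
      map_smul' := fun a v => by
        rw [map_smul, map_smulₛₗ, map_smul, smul_comm] }
  boundary k v := by
    obtain ⟨p, rfl⟩ := (degreeOneEquiv L n).surjective v
    have h : koszulDifferential e 0 (C.koszulMap k 1 p) =
        C.koszulMap k 0 (koszulDifferential e 0 p) := by
      have := C.comm_d k 1 0 p
      rw [koszulComplex_d] at this
      exact this.symm
    change koszulBoundary e (C.degreeZeroInv k • degreeOneEquiv L n (C.koszulMap k 1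
      ((degreeOneEquiv L n).symm (degreeOneEquiv L n p)))) = _
    -- The chain map property leaves the factor `degreeZeroUnit k`, which the rescaling cancels.
    rw [LinearEquiv.symm_apply_apply, map_smul,
      koszulBoundary_degreeOneEquiv e _ OrderEmbedding.ofIsEmpty,
      koszulBoundary_degreeOneEquiv e _ OrderEmbedding.ofIsEmpty, h, C.koszulMap_zero, smul_eq_mul,
      mul_left_comm, C.degreeZeroInv_mul_unit, mul_one]
  map_mul k k' v := by
    change C.degreeZeroInv (k * k') •
        degreeOneEquiv L n (C.koszulMap (k * k') 1 ((degreeOneEquiv L n).symm v)) =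
      C.degreeZeroInv k • degreeOneEquiv L n (C.koszulMap k 1 ((degreeOneEquiv L n).symm
        (C.degreeZeroInv k' • degreeOneEquiv L n (C.koszulMap k' 1
          ((degreeOneEquiv L n).symm v)))))
    rw [map_smul, LinearEquiv.symm_apply_apply, map_smulₛₗ, map_smul, smul_smul,
      C.degreeZeroInv_mul]
    exact congrArg _ (congrArg _ (C.map_mul k k' 1 _))
  map_one v := by
    change C.degreeZeroInv 1 •
      degreeOneEquiv L n (C.koszulMap 1 1 ((degreeOneEquiv L n).symm v)) = v
    rw [C.degreeZeroInv_one, one_smul,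
      show C.koszulMap 1 1 ((degreeOneEquiv L n).symm v) = (degreeOneEquiv L n).symm v from
        C.map_one 1 _, LinearEquiv.apply_symm_apply]

end OfCompatible

theorem DegreeOneAction.exists_lift {e : Module.Basis (Fin n) ℤ L} (A : DegreeOneAction K e)
    (k : K) (x : FreeMetabelianGroup n) :
    ∃ y, foxDeriv e y = A.T k (foxDeriv e x) ∧ toLattice e y = k • toLattice e x := by
  refine exists_foxDeriv_eq e ?_
  rw [A.boundary, koszulBoundary_foxDeriv, map_sub, groupRingMap_groupElt, groupRingMap_groupElt,
    smul_zero]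

/-- `D` and `toLattice` jointly separate elements, so every law of the action follows from the laws
on `(ℤL)ⁿ` and `L`. -/
theorem DegreeOneAction.actionLifts {e : Module.Basis (Fin n) ℤ L} (A : DegreeOneAction K e) :
    ActionLiftsToFreeMetabelianGroup K e := by
  choose f hD hL using A.exists_lift
  let _ : MulDistribMulAction K (FreeMetabelianGroup n) :=
    { smul := f
      one_smul := fun x => foxDeriv_injective e
        ((hD 1 x).trans (A.map_one _)) ((hL 1 x).trans (one_smul _ _))
      mul_smul := fun k k' x => foxDeriv_injective e
        ((hD _ x).trans <| (A.map_mul k k' _).trans <| by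
          rw [← hD k']
          exact (hD k _).symm)
        ((hL _ x).trans <| (mul_smul k k' _).trans <| by
          rw [← hL k']
          exact (hL k _).symm)
      smul_mul := fun k x y => foxDeriv_injective e
        ((hD k _).trans <| by
          rw [foxDeriv_mul, map_add, map_smulₛₗ, groupRingMap_groupElt, ← hL, ← hD, ← hD]
          exact (foxDeriv_mul e (f k x) (f k y)).symm)
        ((hL k _).trans <| by
          rw [toLattice_mul, smul_add, ← hL, ← hL]
          exact (toLattice_mul e (f k x) (f k y)).symm)
      smul_one := fun k => foxDeriv_injective e
        ((hD k 1).trans <| by rw [foxDeriv_one, map_zero])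
        ((hL k 1).trans <| by rw [toLattice_one, smul_zero]) }
  exact ⟨MulDistribMulAction.toMulAut K (FreeMetabelianGroup n), hL⟩

/-- The semilinear map with given values on the basis vectors. -/
def semilinearConstr (k : K) (f : Fin n → Fin n → ℤ[L]) :
    (Fin n → ℤ[L]) →ₛₗ[groupRingMap L k] (Fin n → ℤ[L]) where
  toFun v := ∑ i, groupRingMap L k (v i) • f i
  map_add' v w := by simp [add_smul, Finset.sum_add_distrib]
  map_smul' a v := by simp [mul_smul, Finset.smul_sum]

theorem semilinearConstr_single (k : K) (f : Fin n → Fin n → ℤ[L]) (i : Fin n) :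
    semilinearConstr k f (Pi.single i 1) = f i := by
  change ∑ j, groupRingMap L k ((Pi.single i 1 : Fin n → ℤ[L]) j) • f j = f i
  rw [Finset.sum_eq_single i]
  · simp
  · intro j _ hj
    simp [hj]
  · simp

theorem semilinearMap_pi_ext {φ : ℤ[L] →+* ℤ[L]} {N : Type*} [AddCommGroup N] [Module ℤ[L] N]
    {f g : (Fin n → ℤ[L]) →ₛₗ[φ] N} (h : ∀ i, f (Pi.single i 1) = g (Pi.single i 1)) : f = g :=
  (Pi.basisFun ℤ[L] (Fin n)).ext fun i => by simpa using h i

/-- A lift of the action to the free metabelian group gives an action in degree one by Fox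
derivatives. -/
def degreeOneActionOfLift (φ : K →* MulAut (FreeMetabelianGroup n))
    (hφ : ∀ k x, toLattice e (φ k x) = k • toLattice e x) : DegreeOneAction K e :=
  let T (k : K) := semilinearConstr (L := L) k fun i => foxDeriv e (φ k (.of i))
  -- Both sides are derivations along `x ↦ k • toLattice e x`, so generators suffice. The fields
  -- below reduce to this identity, since `[i]` is the Fox derivative of `x_i`.
  have hT (k : K) (x : FreeMetabelianGroup n) :
      T k (foxDeriv e x) = foxDeriv e (φ k x) := by
    refine derivation_ext (f := fun x => k • toLattice e x)
      (D := fun x => T k (foxDeriv e x)) (D' := fun x => foxDeriv e (φ k x)) ?_ ?_ ?_ ?_ x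
    · intro x y
      rw [toLattice_mul, smul_add]
    · intro x y
      rw [foxDeriv_mul, map_add, map_smulₛₗ, groupRingMap_groupElt]
    · intro x y
      rw [map_mul, foxDeriv_mul, hφ]
    · intro i
      rw [foxDeriv_of, semilinearConstr_single]
  { T := T
    boundary := fun k v => by
      have : (koszulBoundary e).comp (T k) =
          (groupRingMap L k).toSemilinearMap.comp (koszulBoundary e) :=
        semilinearMap_pi_ext fun i => by
          rw [LinearMap.comp_apply, LinearMap.comp_apply, ← foxDeriv_of e, hT,
            koszulBoundary_foxDeriv, koszulBoundary_foxDeriv, hφ]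
          change _ = groupRingMap L k _
          rw [map_sub, groupRingMap_groupElt, groupRingMap_groupElt, smul_zero]
      exact DFunLike.congr_fun this v
    map_mul := fun k k' v => by
      have := groupRingMap_compTriple (L := L) k k'
      have : T (k * k') = (T k).comp (T k') := semilinearMap_pi_ext fun i => by
        rw [LinearMap.comp_apply, ← foxDeriv_of e, hT, hT, hT, map_mul, MulAut.mul_apply]
      exact DFunLike.congr_fun this v
    map_one := fun v => by
      rw [pi_eq_sum_univ' v]
      rw [map_sum]
      refine Finset.sum_congr rfl fun i _ => ?_
      rw [map_smulₛₗ, ← foxDeriv_of e, hT, map_one, MulAut.one_apply, groupRingMap_one] }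

end Actions

end

theorem mainTheorem6 {K : Type*} [Group K] {L : Type*} [AddCommGroup L] [DistribMulAction K L]
    {n : ℕ} (e : Module.Basis (Fin n) ℤ L) :
    Nonempty (CompatibleAction K (koszulComplex e) (koszulAugmentation e)) ↔
      ActionLiftsToFreeMetabelianGroup K e :=
  ⟨fun ⟨C⟩ => C.toDegreeOneAction.actionLifts,
    fun ⟨φ, hφ⟩ => ⟨(degreeOneActionOfLift e φ hφ).toCompatibleAction⟩⟩
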